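/- Let $\gamma>0$, and let $U,\Omega\in C^1(\mathbb{R}^3;\mathbb{R}^3)$ be a classical solution on $\mathbb{R}^3$ of the stationary self-similar Euler equations in vorticity form, \[ \Omega+\gamma\,(y\cdot\nabla)\Omega+(U\cdot\nabla)\Omega=(\Omega\cdot\nabla)U,\qquad \Omega=\nabla\times U,\qquad \nabla\cdot U=0, \] with $\Omega\not\equiv 0$. Assume that there is a constant $C>0$ such that, with $\langle y\rangle=(1+|y|^2)^{1/2}$, \[ |U(y)|\le C\,|y|\,\langle y\rangle^{-1/\gamma}\qquad\text{and}\qquad |\Omega(y)|+|\nabla U(y)|\le C\,\langle y\rangle^{-1/\gamma}\qquad\text{for all } y\in\mathbb{R}^3 . \] Then for every real $p\ge 1$ with $p>3\gamma$, \[ \|\nabla\Omega\|_{L^\infty(\mathbb{R}^3)}^{\frac{3}{p+3}}\;\|\Omega\|_{L^p(\mathbb{R}^3)}^{\frac{p}{p+3}}\;\ge\; C_p^{-1}, \qquad C_p:=2\cdot 6^{\frac{3}{p+3}}\Bigl(\frac{3}{4\pi}\Bigr)^{\frac{1}{p+3}}(p-1)^{\frac{p-1}{p+3}} . \] Here $0^0=1$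 (so that $C_1=2\cdot 6^{3/4}(3/(4\pi))^{1/4}$), $|\nabla U|$ and $|\nabla\Omega|$ are the operator norms of the Jacobian matrices with respect to the Euclidean norm, and the left-hand side is $+\infty$ if $\nabla\Omega$ is unbounded. -/

import Mathlib

open MeasureTheory
open scoped ENNReal

noncomputable section

/-- Three-dimensional Euclidean space. -/
abbrev R3 : Type := EuclideanSpace ℝ (Fin 3)

/-- The partial derivative `∂ᵢ Fʲ (y)` of a vector field. -/
def partialD (F : R3 → R3) (i j : Fin 3) (y : R3) : ℝ :=
  fderiv ℝ F y (EuclideanSpace.single i 1) j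

/-- The divergence `∇ · F`. -/
def divergence (F : R3 → R3) (y : R3) : ℝ := ∑ i, partialD F i i y

/-- The curl `∇ × F`. -/
def curl (F : R3 → R3) (y : R3) : R3 :=
  !₂[partialD F 1 2 y - partialD F 2 1 y,
     partialD F 2 0 y - partialD F 0 2 y,
     partialD F 0 1 y - partialD F 1 0 y]

/-- The directional derivative `((a · ∇) F)(y)`, where `a` is a vector. -/
def advect (a : R3) (F : R3 → R3) (y : R3) : R3 := fderiv ℝ F y a

/-- `(U, Ω)` is a classical solution on the whole space of the stationary self-similar Euler
equations in vorticity form with similarity exponent `γ`: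
`Ω + γ (y · ∇) Ω + (U · ∇) Ω = (Ω · ∇) U`, `Ω = ∇ × U`, `∇ · U = 0`. -/
structure IsSelfSimilarEuler (γ : ℝ) (U Ω : R3 → R3) : Prop where
  contDiff_velocity : ContDiff ℝ 1 U
  contDiff_vorticity : ContDiff ℝ 1 Ω
  equation : ∀ y, Ω y + γ • advect y Ω y + advect (U y) Ω y = advect (Ω y) U y
  vorticity_eq : ∀ y, Ω y = curl U y
  div_free : ∀ y, divergence U y = 0

/-- The Japanese bracket `⟨y⟩ = (1 + |y|²)^{1/2}`. -/
def bracket (y : R3) : ℝ := Real.sqrt (1 + ‖y‖ ^ 2)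

/-- The decay bounds: for some constant `C > 0` and all `y`,
`|U(y)| ≤ C |y| ⟨y⟩^{-1/γ}` and `|Ω(y)| + |∇U(y)| ≤ C ⟨y⟩^{-1/γ}`. -/
def HasProfileDecay (γ : ℝ) (U Ω : R3 → R3) : Prop :=
  ∃ C : ℝ, 0 < C ∧ ∀ y,
    ‖U y‖ ≤ C * ‖y‖ * bracket y ^ (-(1 / γ)) ∧
    ‖Ω y‖ + ‖fderiv ℝ U y‖ ≤ C * bracket y ^ (-(1 / γ))

/-- The constant
`C_p = 2 · 6^{3/(p+3)} (3/(4π))^{1/(p+3)} (p-1)^{(p-1)/(p+3)}` (used for `p ≥ 1`). -/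
def stretchConst (p : ℝ) : ℝ :=
  2 * (6 : ℝ) ^ (3 / (p + 3)) * (3 / (4 * Real.pi)) ^ (1 / (p + 3)) *
    (p - 1) ^ ((p - 1) / (p + 3))

end

/-! Since `Ω` decays, `|Ω|` attains its maximum at some `x`; put `w = Ω x`. There the derivative of
`|Ω|²` vanishes, so pairing the equation with `w` kills both transport terms and leaves `w · ∇U(x) w
= |w|²`: the stretching rate is exactly one (`inner_strain_eq_of_max`).

Biot–Savart bounds that strain from above by the vorticity. The quadratic form in `w` of the kernel
sees `Ω(x + y)` only through `(y · w) (y × w) · Ω(x + y)`, which is blind to multiples of `w`. Hence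
`w` may be subtracted from `Ω(x + y)` for `|y| < R`, where the mean value theorem gains a factor
`|y|` and makes `|y|⁻³` integrable; for `|y| ≥ R` Hölder's inequality brings in the `L^p` norm
(`radius_bound`). Dividing by `3|w|²` leaves a scale-invariant inequality in `R`, and balancing its
two terms gives the product of norms.

No singular integral is needed: the Newtonian potential is replaced by `(|y|² + a)^(-1/2) - (|y|² +
b)^(-1/2)`, which is smooth at `0` and decays faster at infinity. Integrating by parts against it
yields an exact identity (`integral_strain_mul_trace`); the pointwise bound on the resulting
integrand does not depend on `a, b`, so `a → 0`, `b → ∞` recovers the strain at the origin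
(`enorm_strain_le_lintegral`). -/

/-! ### Radial integrals in three dimensions. -/

lemma integral_radial_R3 (f : ℝ → ℝ) :
    ∫ y : R3, f ‖y‖ = 4 * Real.pi * ∫ r in Set.Ioi (0 : ℝ), r ^ 2 * f r := by
  have hv : (volume : Measure R3).real (Metric.ball 0 1) = Real.pi * 4 / 3 := by
    rw [Measure.real, EuclideanSpace.volume_ball_fin_three]
    simp [ENNReal.toReal_ofReal (by positivity : 0 ≤ Real.pi * 4 / 3)]
  rw [integral_fun_norm_addHaar volume f, hv]
  simp
  ring

lemma integrable_radial_R3 {f : ℝ → ℝ} :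
    Integrable (fun y : R3 => f ‖y‖) ↔
      IntegrableOn (fun r : ℝ => r ^ 2 * f r) (Set.Ioi 0) := by
  rw [integrable_fun_norm_addHaar volume (f := f)]
  simp

lemma lintegral_radial_R3 {f : ℝ → ℝ} (h0 : ∀ r, 0 < r → 0 ≤ f r)
    (hf : IntegrableOn (fun r : ℝ => r ^ 2 * f r) (Set.Ioi 0)) :
    ∫⁻ y : R3, ENNReal.ofReal (f ‖y‖) =
      ENNReal.ofReal (4 * Real.pi * ∫ r in Set.Ioi (0 : ℝ), r ^ 2 * f r) := by
  rw [← integral_radial_R3, ofReal_integral_eq_lintegral_ofReal (integrable_radial_R3.2 hf)]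
  filter_upwards [compl_mem_ae_iff.2 (measure_singleton (0 : R3))] with y hy
  exact h0 _ (norm_pos_iff.2 hy)

/-- The bump `(1 + |y|²)^{-5/2}` has total integral `4π/3`. -/
lemma integral_bump :
    ∫ y : R3, (1 + ‖y‖ ^ 2) ^ (-(5 / 2) : ℝ) = 4 * Real.pi / 3 := by
  rw [integral_radial_R3 (fun r => (1 + r ^ 2) ^ (-(5 / 2) : ℝ))]
  -- An explicit primitive, vanishing at `0` and tending to `1/3`.
  have hd : ∀ r ∈ Set.Ici (0 : ℝ), HasDerivAt
      (fun r : ℝ => r ^ 3 / 3 * (1 + r ^ 2) ^ (-(3 / 2) : ℝ))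
      (r ^ 2 * (1 + r ^ 2) ^ (-(5 / 2) : ℝ)) r := by
    intro r _
    have hp : 0 < 1 + r ^ 2 := by positivity
    have h1 : HasDerivAt (fun r : ℝ => 1 + r ^ 2) (2 * r) r := by
      simpa using (hasDerivAt_pow 2 r).const_add 1
    have h2 := ((hasDerivAt_pow 3 r).div_const 3).mul
      (h1.rpow_const (p := -(3 / 2)) (Or.inl hp.ne'))
    refine h2.congr_deriv ?_
    have e : (1 + r ^ 2) ^ (-(3 / 2) : ℝ) = (1 + r ^ 2) ^ (-(5 / 2) : ℝ) * (1 + r ^ 2) := by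
      rw [← Real.rpow_add_one hp.ne']; norm_num
    norm_num
    rw [e]; ring
  have hlim : Filter.Tendsto (fun r : ℝ => r ^ 3 / 3 * (1 + r ^ 2) ^ (-(3 / 2) : ℝ))
      Filter.atTop (nhds (1 / 3)) := by
    have h1 : Filter.Tendsto (fun r : ℝ => 1 / 3 * ((r ^ 2)⁻¹ + 1) ^ (-(3 / 2) : ℝ))
        Filter.atTop (nhds (1 / 3 * (0 + 1) ^ (-(3 / 2) : ℝ))) := by
      have h2 : Filter.Tendsto (fun r : ℝ => (r ^ 2)⁻¹ + 1) Filter.atTop (nhds (0 + 1)) :=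
        ((Filter.tendsto_pow_atTop two_ne_zero).inv_tendsto_atTop).add_const 1
      exact (h2.rpow_const (Or.inl (by norm_num))).const_mul _
    simp only [zero_add, Real.one_rpow, mul_one] at h1
    refine h1.congr' ?_
    filter_upwards [Filter.eventually_gt_atTop 0] with r hr
    have : 1 + r ^ 2 = r ^ 2 * ((r ^ 2)⁻¹ + 1) := by field_simp
    rw [this, Real.mul_rpow (by positivity) (by positivity), ← Real.rpow_natCast r 2,
      ← Real.rpow_mul hr.le]
    norm_num
    field_simp
  rw [integral_Ioi_of_hasDerivAt_of_nonneg' hd (fun r _ => by positivity) hlim]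
  norm_num
  ring

lemma integrable_bump : Integrable (fun y : R3 => (1 + ‖y‖ ^ 2) ^ (-(5 / 2) : ℝ)) := by
  simpa [neg_div] using
    integrable_rpow_neg_one_add_norm_sq (E := R3) (μ := volume) (r := 5) (by norm_num)

lemma setLIntegral_ball_inv_sq {R : ℝ} (hR : 0 < R) :
    ∫⁻ y in Metric.ball (0 : R3) R, ENNReal.ofReal ((‖y‖ ^ 2)⁻¹) =
      ENNReal.ofReal (4 * Real.pi * R) := by
  have e : Set.EqOn (fun r : ℝ => r ^ 2 * (Set.Iio R).indicator (fun r => (r ^ 2)⁻¹) r)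
      ((Set.Iio R).indicator fun _ => 1) (Set.Ioi 0) := by
    intro r hr
    by_cases h : r < R
    · simp [h, (Set.mem_Ioi.1 hr).ne']
    · simp [h]
  have h := lintegral_radial_R3 (f := (Set.Iio R).indicator fun r => (r ^ 2)⁻¹)
    (fun r _ => Set.indicator_nonneg (fun _ _ => by positivity) r)
    (by
      rw [integrableOn_congr_fun e measurableSet_Ioi, IntegrableOn,
        integrable_indicator_iff measurableSet_Iio, IntegrableOn,
        Measure.restrict_restrict measurableSet_Iio]
      simp [Set.Iio_inter_Ioi])
  rw [setIntegral_congr_fun measurableSet_Ioi e, integral_indicator measurableSet_Iio,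
    Measure.restrict_restrict measurableSet_Iio, Set.Iio_inter_Ioi] at h
  rw [← lintegral_indicator Metric.isOpen_ball.measurableSet]
  simp only [integral_const, MeasurableSet.univ, measureReal_restrict_apply, Set.univ_inter,
    Real.volume_real_Ioo, sub_zero, max_eq_left hR.le, smul_eq_mul, mul_one] at h
  rw [← h]
  congr 1 with y
  by_cases hy : ‖y‖ < R <;> simp [hy]

lemma setLIntegral_compl_ball_rpow {R s : ℝ} (hR : 0 < R) (hs : 3 < s) :
    ∫⁻ y in (Metric.ball (0 : R3) R)ᶜ, ENNReal.ofReal (‖y‖ ^ (-s)) =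
      ENNReal.ofReal (4 * Real.pi * (R ^ (3 - s) / (s - 3))) := by
  have e : Set.EqOn (fun r : ℝ => r ^ 2 * (Set.Ici R).indicator (fun r => r ^ (-s)) r)
      ((Set.Ici R).indicator fun r => r ^ (2 - s)) (Set.Ioi 0) := by
    intro r hr
    by_cases h : R ≤ r
    · simp only [Set.mem_Ici, h, Set.indicator_of_mem]
      rw [sub_eq_add_neg, Real.rpow_add hr]
      norm_num
    · simp [h]
  have e2 : Set.Ici R ∩ Set.Ioi 0 = Set.Ici R :=
    Set.inter_eq_left.2 fun r hr => lt_of_lt_of_le hR hr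
  have h := lintegral_radial_R3 (f := (Set.Ici R).indicator fun r => r ^ (-s))
    (fun r hr => by
      by_cases h : R ≤ r
      · simpa [h] using Real.rpow_nonneg hr.le _
      · simp [h])
    (by
      rw [integrableOn_congr_fun e measurableSet_Ioi, IntegrableOn,
        integrable_indicator_iff measurableSet_Ici, IntegrableOn,
        Measure.restrict_restrict measurableSet_Ici, e2]
      exact (integrableOn_Ici_iff_integrableOn_Ioi).2
        (integrableOn_Ioi_rpow_of_lt (by linarith) hR))
  rw [setIntegral_congr_fun measurableSet_Ioi e, integral_indicator measurableSet_Ici,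
    Measure.restrict_restrict measurableSet_Ici, e2, integral_Ici_eq_integral_Ioi,
    integral_Ioi_rpow_of_lt (by linarith) hR] at h
  rw [← lintegral_indicator Metric.isOpen_ball.measurableSet.compl]
  have e3 : -R ^ (2 - s + 1) / (2 - s + 1) = R ^ (3 - s) / (s - 3) := by
    rw [show 2 - s + 1 = 3 - s by ring, show s - 3 = -(3 - s) by ring, div_neg, neg_div]
  rw [← e3, ← h]
  congr 1 with y
  by_cases hy : R ≤ ‖y‖ <;> simp [hy]

/-! ### The truncated kernel, its derivatives and their decay. -/

/-- The difference `(t + a)^{-s} - (t + b)^{-s}`. -/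
noncomputable def rpowGap (s a b t : ℝ) : ℝ := (t + a) ^ (-s) - (t + b) ^ (-s)

lemma hasDerivAt_rpowGap (s : ℝ) {a b t : ℝ} (ha : 0 < a) (hb : 0 < b) (ht : 0 ≤ t) :
    HasDerivAt (rpowGap s a b) (-s * rpowGap (s + 1) a b t) t := by
  have h (c : ℝ) (hc : 0 < c) : HasDerivAt (fun t : ℝ => (t + c) ^ (-s))
      (-s * (t + c) ^ (-(s + 1))) t := by
    have := ((hasDerivAt_id t).add_const c).rpow_const (p := -s)
      (Or.inl (by simp; positivity))
    refine this.congr_deriv ?_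
    simp; left; ring_nf
  refine ((h a ha).sub (h b hb)).congr_deriv ?_
  simp only [rpowGap]; ring

lemma rpowGap_nonneg {s a b t : ℝ} (hs : 0 ≤ s) (ha : 0 < a) (hab : a ≤ b) (ht : 0 ≤ t) :
    0 ≤ rpowGap s a b t :=
  sub_nonneg.2 (Real.rpow_le_rpow_of_nonpos (by positivity) (by linarith) (by linarith))

lemma rpowGap_le {s a b t : ℝ} (hs : 0 ≤ s) (ha : 0 < a) (hab : a ≤ b) (ht : 0 ≤ t) :
    rpowGap s a b t ≤ s * (b - a) * (t + a) ^ (-(s + 1)) := by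
  have hd : ∀ x ∈ Set.Icc a b, HasDerivWithinAt (fun x : ℝ => (t + x) ^ (-s))
      (-s * (t + x) ^ (-(s + 1))) (Set.Icc a b) x := by
    intro x hx
    have hx0 : 0 < t + x := by linarith [hx.1]
    have := ((hasDerivAt_id x).const_add t).rpow_const (p := -s) (Or.inl hx0.ne')
    refine (this.congr_deriv ?_).hasDerivWithinAt
    simp; left; ring_nf
  have h := (convex_Icc a b).norm_image_sub_le_of_norm_hasDerivWithin_le hd
    (C := s * (t + a) ^ (-(s + 1))) (fun x hx => by
      have hx0 : 0 < t + x := by linarith [hx.1]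
      rw [norm_mul, norm_neg, Real.norm_of_nonneg hs,
        Real.norm_of_nonneg (Real.rpow_nonneg hx0.le _)]
      exact mul_le_mul_of_nonneg_left
        (Real.rpow_le_rpow_of_nonpos (by positivity) (by linarith [hx.1]) (by linarith)) hs)
    (Set.left_mem_Icc.2 hab) (Set.right_mem_Icc.2 hab)
  rw [norm_sub_rev, Real.norm_of_nonneg (sub_nonneg.2 hab)] at h
  calc _ ≤ _ := le_trans (le_abs_self _) h
    _ = _ := by ring

/-- Subtracting the two powers cancels the leading term at infinity, which gains one power of `t`.
With `t = |y|²` this is two extra powers of `|y|`, enough to integrate by parts against a field of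
linear growth. -/
lemma abs_rpowGap_le {s a b : ℝ} (hs : 0 ≤ s) (ha : 0 < a) (hab : a ≤ b) :
    ∃ K, 0 ≤ K ∧ ∀ t, 0 ≤ t → |rpowGap s a b t| ≤ K * (1 + t) ^ (-(s + 1)) := by
  have hm : 0 < min a 1 := lt_min ha one_pos
  refine ⟨s * (b - a) * (min a 1) ^ (-(s + 1)), ?_, fun t ht => ?_⟩
  · have := sub_nonneg.2 hab; positivity
  rw [abs_of_nonneg (rpowGap_nonneg hs ha hab ht), mul_assoc,
    ← Real.mul_rpow hm.le (by positivity)]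
  refine (rpowGap_le hs ha hab ht).trans (mul_le_mul_of_nonneg_left ?_
    (mul_nonneg hs (sub_nonneg.2 hab)))
  refine Real.rpow_le_rpow_of_nonpos (by positivity) ?_ (by linarith)
  -- The comparison is `min a 1 * (1 + t) ≤ t + a`.
  nlinarith [min_le_left a 1, min_le_right a 1]

/-- The entries of the Hessian of the truncated Newtonian potential. -/
noncomputable def gapHess (a b : ℝ) (i j : Fin 3) (y : R3) : ℝ :=
  (if i = j then 1 else 0) * rpowGap (3 / 2) a b (‖y‖ ^ 2) -
    3 * (y i * y j) * rpowGap (5 / 2) a b (‖y‖ ^ 2)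

/-- The third derivatives of the truncated Newtonian potential. -/
noncomputable def gapThird (a b : ℝ) (k i j : Fin 3) (y : R3) : ℝ :=
  -3 * ((if i = j then 1 else 0) * y k + (if k = i then 1 else 0) * y j +
    (if k = j then 1 else 0) * y i) * rpowGap (5 / 2) a b (‖y‖ ^ 2) +
    15 * (y k * y i * y j) * rpowGap (7 / 2) a b (‖y‖ ^ 2)

/-- Third derivatives of a potential commute; this symmetry is what allows derivatives to be
exchanged between field and kernel. -/
lemma gapThird_swap (a b : ℝ) (k i j : Fin 3) : gapThird a b k i j = gapThird a b i k j := by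
  funext y
  simp only [gapThird, eq_comm (a := i) (b := k)]
  ring

lemma gapHess_symm (a b : ℝ) (i j : Fin 3) : gapHess a b i j = gapHess a b j i := by
  funext y
  simp only [gapHess, eq_comm (a := i) (b := j), mul_comm (y i)]

lemma hasFDerivAt_rpowGap_norm_sq (s : ℝ) {a b : ℝ} (ha : 0 < a) (hb : 0 < b) (y : R3) :
    HasFDerivAt (fun y : R3 => rpowGap s a b (‖y‖ ^ 2))
      ((-s * rpowGap (s + 1) a b (‖y‖ ^ 2)) • (2 • innerSL ℝ y)) y :=
  HasDerivAt.comp_hasFDerivAt (h₂ := rpowGap s a b) y (hasDerivAt_rpowGap s ha hb (sq_nonneg ‖y‖))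
    (hasStrictFDerivAt_norm_sq y).hasFDerivAt

lemma hasFDerivAt_coord (i : Fin 3) (y : R3) :
    HasFDerivAt (fun y : R3 => y i) (EuclideanSpace.proj (𝕜 := ℝ) i) y :=
  (EuclideanSpace.proj (𝕜 := ℝ) i : R3 →L[ℝ] ℝ).hasFDerivAt

lemma differentiable_gapHess {a b : ℝ} (ha : 0 < a) (hb : 0 < b) (i j : Fin 3) :
    Differentiable ℝ (gapHess a b i j) := fun y =>
  (((hasFDerivAt_rpowGap_norm_sq (3 / 2) ha hb y).const_mul _).sub
    ((((hasFDerivAt_coord i y).mul (hasFDerivAt_coord j y)).const_mul 3).mul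
      (hasFDerivAt_rpowGap_norm_sq (5 / 2) ha hb y))).differentiableAt

lemma fderiv_gapHess_single {a b : ℝ} (ha : 0 < a) (hb : 0 < b) (k i j : Fin 3) (y : R3) :
    fderiv ℝ (gapHess a b i j) y (EuclideanSpace.single k 1) = gapThird a b k i j y := by
  have h := (((hasFDerivAt_rpowGap_norm_sq (3 / 2) ha hb y).const_mul
    (if i = j then (1 : ℝ) else 0)).sub
    ((((hasFDerivAt_coord i y).mul (hasFDerivAt_coord j y)).const_mul 3).mul
      (hasFDerivAt_rpowGap_norm_sq (5 / 2) ha hb y)))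
  have h' : HasFDerivAt (gapHess a b i j) _ y := h
  rw [h'.fderiv]
  have e1 : (3 / 2 + 1 : ℝ) = 5 / 2 := by norm_num
  have e2 : (5 / 2 + 1 : ℝ) = 7 / 2 := by norm_num
  simp only [gapThird, e1, e2]
  simp only [sub_apply, add_apply, smul_apply, nsmul_eq_mul,
    innerSL_apply_apply, EuclideanSpace.inner_single_right, PiLp.proj_apply]
  simp [eq_comm (a := k)]
  split_ifs <;> ring

lemma continuous_gapThird {a b : ℝ} (ha : 0 < a) (hb : 0 < b) (k i j : Fin 3) :
    Continuous (gapThird a b k i j) := by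
  have h (s : ℝ) : Continuous (fun y : R3 => rpowGap s a b (‖y‖ ^ 2)) :=
    Differentiable.continuous (𝕜 := ℝ) fun y =>
      (hasFDerivAt_rpowGap_norm_sq s ha hb y).differentiableAt
  have h5 := h (5 / 2)
  have h7 := h (7 / 2)
  unfold gapThird
  fun_prop

lemma abs_coord_le (y : R3) (i : Fin 3) : |y i| ≤ (1 + ‖y‖ ^ 2) ^ (1 / 2 : ℝ) := by
  rw [← Real.sqrt_eq_rpow]
  refine (PiLp.norm_apply_le y i).trans (Real.le_sqrt_of_sq_le (by linarith))

lemma abs_gapHess_le {a b : ℝ} (ha : 0 < a) (hab : a ≤ b) (i j : Fin 3) :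
    ∃ K, 0 ≤ K ∧ ∀ y, |gapHess a b i j y| ≤ K * (1 + ‖y‖ ^ 2) ^ (-(5 / 2) : ℝ) := by
  obtain ⟨K, hK, h3⟩ := abs_rpowGap_le (s := 3 / 2) (by norm_num) ha hab
  obtain ⟨M, hM, h5⟩ := abs_rpowGap_le (s := 5 / 2) (by norm_num) ha hab
  refine ⟨K + 3 * M, by positivity, fun y => ?_⟩
  have h3 := h3 _ (sq_nonneg ‖y‖)
  have h5 := h5 _ (sq_nonneg ‖y‖)
  have hp : 0 < 1 + ‖y‖ ^ 2 := by positivity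
  have e1 : (-(3 / 2 + 1) : ℝ) = -(5 / 2) := by norm_num
  rw [e1] at h3
  have hi := abs_coord_le y i
  have hj := abs_coord_le y j
  have hd : |(if i = j then (1 : ℝ) else 0)| ≤ 1 := by split_ifs <;> simp
  have e2 : (1 + ‖y‖ ^ 2) ^ (1 / 2 : ℝ) * (1 + ‖y‖ ^ 2) ^ (1 / 2 : ℝ) *
      (M * (1 + ‖y‖ ^ 2) ^ (-(5 / 2 + 1) : ℝ)) = M * (1 + ‖y‖ ^ 2) ^ (-(5 / 2) : ℝ) := by
    rw [mul_left_comm, ← Real.rpow_add hp, ← Real.rpow_add hp]; norm_num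
  calc |gapHess a b i j y| ≤ _ := abs_sub _ _
    _ = |(if i = j then (1 : ℝ) else 0)| * |rpowGap (3 / 2) a b (‖y‖ ^ 2)| +
        3 * (|y i| * |y j| * |rpowGap (5 / 2) a b (‖y‖ ^ 2)|) := by
        simp only [abs_mul]; norm_num; ring
    _ ≤ 1 * (K * (1 + ‖y‖ ^ 2) ^ (-(5 / 2) : ℝ)) + 3 * ((1 + ‖y‖ ^ 2) ^ (1 / 2 : ℝ) *
        (1 + ‖y‖ ^ 2) ^ (1 / 2 : ℝ) * (M * (1 + ‖y‖ ^ 2) ^ (-(5 / 2 + 1) : ℝ))) := by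
        gcongr
    _ = _ := by rw [e2]; ring

lemma abs_gapThird_le {a b : ℝ} (ha : 0 < a) (hab : a ≤ b) (k i j : Fin 3) :
    ∃ K, 0 ≤ K ∧ ∀ y, |gapThird a b k i j y| ≤ K * (1 + ‖y‖ ^ 2) ^ (-3 : ℝ) := by
  obtain ⟨K, hK, h5⟩ := abs_rpowGap_le (s := 5 / 2) (by norm_num) ha hab
  obtain ⟨M, hM, h7⟩ := abs_rpowGap_le (s := 7 / 2) (by norm_num) ha hab
  refine ⟨9 * K + 15 * M, by positivity, fun y => ?_⟩
  have h5 := h5 _ (sq_nonneg ‖y‖)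
  have h7 := h7 _ (sq_nonneg ‖y‖)
  have hp : 0 < 1 + ‖y‖ ^ 2 := by positivity
  have hi := abs_coord_le y i
  have hj := abs_coord_le y j
  have hk := abs_coord_le y k
  have hd (i j : Fin 3) (x : ℝ) : |(if i = j then (1 : ℝ) else 0) * x| ≤ |x| := by
    split_ifs <;> simp
  set B := (1 + ‖y‖ ^ 2) ^ (1 / 2 : ℝ) with hB
  have hB0 : 0 ≤ B := by positivity
  have e1 : B * (K * (1 + ‖y‖ ^ 2) ^ (-(5 / 2 + 1) : ℝ)) = K * (1 + ‖y‖ ^ 2) ^ (-3 : ℝ) := by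
    rw [hB, mul_left_comm, ← Real.rpow_add hp]; norm_num
  have e2 : B * B * B * (M * (1 + ‖y‖ ^ 2) ^ (-(7 / 2 + 1) : ℝ)) =
      M * (1 + ‖y‖ ^ 2) ^ (-3 : ℝ) := by
    rw [hB, mul_left_comm, ← Real.rpow_add hp, ← Real.rpow_add hp, ← Real.rpow_add hp]; norm_num
  have hs : |(if i = j then (1 : ℝ) else 0) * y k + (if k = i then 1 else 0) * y j +
      (if k = j then 1 else 0) * y i| ≤ 3 * B := by
    refine (abs_add_three _ _ _).trans ?_
    linarith [hd i j (y k), hd k i (y j), hd k j (y i)]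
  calc |gapThird a b k i j y| ≤ _ := abs_add_le _ _
    _ = 3 * (|(if i = j then (1 : ℝ) else 0) * y k + (if k = i then 1 else 0) * y j +
      (if k = j then 1 else 0) * y i| * |rpowGap (5 / 2) a b (‖y‖ ^ 2)|) +
        15 * (|y k| * |y i| * |y j| * |rpowGap (7 / 2) a b (‖y‖ ^ 2)|) := by
        simp only [abs_mul, abs_neg]; norm_num; ring
    _ ≤ 3 * (3 * B * (K * (1 + ‖y‖ ^ 2) ^ (-(5 / 2 + 1) : ℝ))) +
        15 * (B * B * B * (M * (1 + ‖y‖ ^ 2) ^ (-(7 / 2 + 1) : ℝ))) := by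
        gcongr
    _ = 9 * (B * (K * (1 + ‖y‖ ^ 2) ^ (-(5 / 2 + 1) : ℝ))) +
        15 * (B * B * B * (M * (1 + ‖y‖ ^ 2) ^ (-(7 / 2 + 1) : ℝ))) := by ring
    _ = _ := by rw [e1, e2]; ring

/-! ### Integration by parts against the truncated kernel. -/

lemma integrable_of_abs_le_rpow {f : R3 → ℝ} {K r : ℝ} (hr : 3 < r) (hf : Continuous f)
    (h : ∀ y, |f y| ≤ K * (1 + ‖y‖ ^ 2) ^ (-r / 2)) : Integrable f :=
  ((integrable_rpow_neg_one_add_norm_sq (E := R3) (μ := volume) (r := r)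
    (by simpa using hr)).const_mul K).mono' hf.aestronglyMeasurable (.of_forall h)

/-- A scalar `C¹` function with bounded gradient and at most linear growth. -/
structure LinearGrowth (f : R3 → ℝ) : Prop where
  contDiff : ContDiff ℝ 1 f
  bound : ∃ C, 0 ≤ C ∧ ∀ y, |f y| ≤ C * (1 + ‖y‖ ^ 2) ^ (1 / 2 : ℝ) ∧ ‖fderiv ℝ f y‖ ≤ C

lemma LinearGrowth.integrable_fderiv_mul {f : R3 → ℝ} (hf : LinearGrowth f) {a b : ℝ}
    (ha : 0 < a) (hab : a ≤ b) (k i j : Fin 3) :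
    Integrable fun y => fderiv ℝ f y (EuclideanSpace.single k 1) * gapHess a b i j y := by
  obtain ⟨C, hC, hb⟩ := hf.bound
  obtain ⟨K, hK, hH⟩ := abs_gapHess_le ha hab i j
  refine integrable_of_abs_le_rpow (r := 5) (K := C * K) (by norm_num)
    (((hf.contDiff.continuous_fderiv one_ne_zero).clm_apply continuous_const).mul
      (differentiable_gapHess ha (ha.trans_le hab) i j).continuous) fun y => ?_
  rw [abs_mul, mul_assoc, neg_div]
  refine mul_le_mul ?_ (hH y) (abs_nonneg _) hC
  simpa using ((fderiv ℝ f y).le_opNorm _).trans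
    (mul_le_mul_of_nonneg_right (hb y).2 (norm_nonneg (EuclideanSpace.single k (1 : ℝ))))

lemma LinearGrowth.integral_fderiv_mul_gapHess {f : R3 → ℝ} (hf : LinearGrowth f) {a b : ℝ}
    (ha : 0 < a) (hab : a ≤ b) (k i j : Fin 3) :
    ∫ y, fderiv ℝ f y (EuclideanSpace.single k 1) * gapHess a b i j y =
      -∫ y, f y * gapThird a b k i j y := by
  obtain ⟨C, hC, hb⟩ := hf.bound
  obtain ⟨K, hK, hH⟩ := abs_gapHess_le ha hab i j
  obtain ⟨M, hM, hT⟩ := abs_gapThird_le ha hab k i j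
  have hb0 := ha.trans_le hab
  have hcf := hf.contDiff.continuous
  have hcH := (differentiable_gapHess ha hb0 i j).continuous
  have h1 : Integrable fun y => f y * gapHess a b i j y := by
    refine integrable_of_abs_le_rpow (r := 4) (K := C * K) (by norm_num) (hcf.mul hcH) fun y => ?_
    have hp : 0 < 1 + ‖y‖ ^ 2 := by positivity
    rw [abs_mul]
    refine (mul_le_mul (hb y).1 (hH y) (abs_nonneg _) (by positivity)).trans_eq ?_
    rw [mul_mul_mul_comm, ← Real.rpow_add hp]; norm_num
  have h2 : Integrable fun y => f y * gapThird a b k i j y := by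
    refine integrable_of_abs_le_rpow (r := 5) (K := C * M) (by norm_num)
      (hcf.mul (continuous_gapThird ha hb0 k i j)) fun y => ?_
    have hp : 0 < 1 + ‖y‖ ^ 2 := by positivity
    rw [abs_mul]
    refine (mul_le_mul (hb y).1 (hT y) (abs_nonneg _) (by positivity)).trans_eq ?_
    rw [mul_mul_mul_comm, ← Real.rpow_add hp]; norm_num
  have h := integral_mul_fderiv_eq_neg_fderiv_mul_of_integrable (μ := (volume : Measure R3))
    (v := EuclideanSpace.single k 1) (hf.integrable_fderiv_mul ha hab k i j)
    (by simpa only [fderiv_gapHess_single ha hb0] using h2) h1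
    (fun y _ => hf.contDiff.differentiable one_ne_zero y)
    (fun y _ => differentiable_gapHess ha hb0 i j y)
  simp only [fderiv_gapHess_single ha hb0] at h
  rw [h, neg_neg]

/-- Both sides move their derivative onto the kernel and meet the same third derivative. -/
lemma LinearGrowth.integral_fderiv_mul_gapHess_swap {f : R3 → ℝ} (hf : LinearGrowth f)
    {a b : ℝ} (ha : 0 < a) (hab : a ≤ b) (k i j : Fin 3) :
    ∫ y, fderiv ℝ f y (EuclideanSpace.single k 1) * gapHess a b i j y =
      ∫ y, fderiv ℝ f y (EuclideanSpace.single i 1) * gapHess a b k j y := by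
  rw [hf.integral_fderiv_mul_gapHess ha hab, hf.integral_fderiv_mul_gapHess ha hab, gapThird_swap]

/-! ### Pointwise algebra of the Biot–Savart integrand. -/

lemma abs_triple_product_le (y w z : R3) :
    |(y 1 * w 2 - y 2 * w 1) * z 0 + (y 2 * w 0 - y 0 * w 2) * z 1 +
      (y 0 * w 1 - y 1 * w 0) * z 2| ≤ ‖y‖ * ‖w‖ * ‖z‖ := by
  refine abs_le_of_sq_le_sq ?_ (by positivity)
  rw [mul_pow, mul_pow]
  simp only [EuclideanSpace.real_norm_sq_eq, Fin.sum_univ_three]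
  set p := y 1 * w 2 - y 2 * w 1 with hp
  set q := y 2 * w 0 - y 0 * w 2 with hq
  set r := y 0 * w 1 - y 1 * w 0 with hr
  have h1 : (p * z 0 + q * z 1 + r * z 2) ^ 2 ≤
      (p ^ 2 + q ^ 2 + r ^ 2) * (z 0 ^ 2 + z 1 ^ 2 + z 2 ^ 2) := by
    nlinarith [sq_nonneg (p * z 1 - q * z 0), sq_nonneg (p * z 2 - r * z 0),
      sq_nonneg (q * z 2 - r * z 1)]
  have h2 : p ^ 2 + q ^ 2 + r ^ 2 ≤ (y 0 ^ 2 + y 1 ^ 2 + y 2 ^ 2) *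
      (w 0 ^ 2 + w 1 ^ 2 + w 2 ^ 2) := by
    rw [hp, hq, hr]
    nlinarith [sq_nonneg (y 0 * w 0 + y 1 * w 1 + y 2 * w 2)]
  exact h1.trans (mul_le_mul_of_nonneg_right h2 (by positivity))

lemma sum_mul_partialD (F : R3 → R3) (w y : R3) :
    ∑ i, ∑ j, w i * w j * partialD F i j y = inner ℝ w (fderiv ℝ F y w) := by
  have hw : w = ∑ i, w i • EuclideanSpace.single i (1 : ℝ) := by
    ext j; fin_cases j <;> simp [Fin.sum_univ_three]
  conv_rhs => enter [3]; rw [hw]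
  rw [map_sum, PiLp.inner_apply, Finset.sum_comm]
  refine Finset.sum_congr rfl fun j _ => ?_
  simp only [map_smul, WithLp.ofLp_sum, Finset.sum_apply, PiLp.smul_apply, smul_eq_mul,
    RCLike.inner_apply, conj_trivial, Finset.sum_mul]
  refine Finset.sum_congr rfl fun i _ => ?_
  simp only [partialD]; ring

lemma rpow_neg_three_halves {x : ℝ} (hx : 0 < x) :
    x ^ (-(3 / 2) : ℝ) = x * x ^ (-(5 / 2) : ℝ) := by
  rw [mul_comm, ← Real.rpow_add_one hx.ne']; norm_num

/-- Each term is a smoothed Dirac mass of total integral `4π`, one at scale `√a` and one at scale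
`√b`: the trace is minus the Laplacian of the truncated potential. -/
lemma sum_gapHess_diag {a b : ℝ} (ha : 0 < a) (hb : 0 < b) (y : R3) :
    ∑ k, gapHess a b k k y = 3 * a * (‖y‖ ^ 2 + a) ^ (-(5 / 2) : ℝ) -
      3 * b * (‖y‖ ^ 2 + b) ^ (-(5 / 2) : ℝ) := by
  have hn := EuclideanSpace.real_norm_sq_eq y
  rw [Fin.sum_univ_three] at hn
  have h1 := rpow_neg_three_halves (x := ‖y‖ ^ 2 + a) (by positivity)
  have h2 := rpow_neg_three_halves (x := ‖y‖ ^ 2 + b) (by positivity)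
  simp only [gapHess, rpowGap, Fin.sum_univ_three, h1, h2, if_true]
  generalize (‖y‖ ^ 2 + a) ^ (-(5 / 2) : ℝ) = A
  generalize (‖y‖ ^ 2 + b) ^ (-(5 / 2) : ℝ) = B
  rw [hn]; ring

/-- The Biot–Savart integrand of the truncated kernel, tested against `w ⊗ w`. -/
noncomputable def stretchIntegrand (a b : ℝ) (V : R3 → R3) (w y : R3) : ℝ :=
  ∑ i, ∑ j, ∑ k, w i * w j * ((partialD V k j y - partialD V j k y) * gapHess a b i k y)

/-- The diagonal part of the kernel drops out because the curl enters antisymmetrically. What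
remains is a triple product containing `w`, so `c • w` can be subtracted for any `c`. Dropping `a`
and the `b` term bounds the kernel uniformly in both parameters. -/
lemma abs_stretchIntegrand_le {a b : ℝ} (ha : 0 < a) (hab : a ≤ b) (V : R3 → R3) (w y : R3)
    (c : ℝ) : |stretchIntegrand a b V w y| ≤
      3 * ‖w‖ ^ 2 * (‖y‖ ^ 3)⁻¹ * ‖curl V y - c • w‖ := by
  have e : stretchIntegrand a b V w y = -3 * rpowGap (5 / 2) a b (‖y‖ ^ 2) * inner ℝ y w *
      ((y 1 * w 2 - y 2 * w 1) * (curl V y - c • w) 0 +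
       (y 2 * w 0 - y 0 * w 2) * (curl V y - c • w) 1 +
       (y 0 * w 1 - y 1 * w 0) * (curl V y - c • w) 2) := by
    simp only [stretchIntegrand, gapHess, Fin.sum_univ_three, PiLp.inner_apply, curl,
      PiLp.sub_apply, PiLp.smul_apply]
    simp
    ring
  have hg0 := rpowGap_nonneg (s := 5 / 2) (by norm_num) ha hab (sq_nonneg ‖y‖)
  have hg : rpowGap (5 / 2) a b (‖y‖ ^ 2) * ‖y‖ ^ 2 ≤ (‖y‖ ^ 3)⁻¹ := by
    rcases eq_or_ne y 0 with rfl | hy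
    · simp
    have hy' : 0 < ‖y‖ := norm_pos_iff.2 hy
    have h1 : rpowGap (5 / 2) a b (‖y‖ ^ 2) ≤ (‖y‖ ^ 2) ^ (-(5 / 2) : ℝ) := by
      refine (sub_le_self _ (Real.rpow_nonneg (by linarith [sq_nonneg ‖y‖]) _)).trans ?_
      exact Real.rpow_le_rpow_of_nonpos (by positivity) (by linarith) (by norm_num)
    have h2 : (‖y‖ ^ 2) ^ (-(5 / 2) : ℝ) = (‖y‖ ^ 5)⁻¹ := by
      rw [← Real.rpow_natCast, ← Real.rpow_mul hy'.le, ← Real.rpow_natCast,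
        ← Real.rpow_neg hy'.le]
      norm_num
    calc _ ≤ (‖y‖ ^ 5)⁻¹ * ‖y‖ ^ 2 := mul_le_mul_of_nonneg_right (h1.trans_eq h2) (sq_nonneg _)
      _ = _ := by field_simp
  rw [e, abs_mul, abs_mul, abs_mul, abs_of_nonneg hg0]
  have h3 := abs_real_inner_le_norm y w
  have h4 := abs_triple_product_le y w (curl V y - c • w)
  calc _ ≤ |(-3 : ℝ)| * rpowGap (5 / 2) a b (‖y‖ ^ 2) * (‖y‖ * ‖w‖) *
        (‖y‖ * ‖w‖ * ‖curl V y - c • w‖) := by gcongr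
    _ = 3 * ‖w‖ ^ 2 * (rpowGap (5 / 2) a b (‖y‖ ^ 2) * ‖y‖ ^ 2) * ‖curl V y - c • w‖ := by
        norm_num; ring
    _ ≤ _ := by gcongr

/-! ### The strain identity for divergence-free fields. -/

section VectorField

variable {V : R3 → R3}

lemma partialD_eq_fderiv_coord (hd : Differentiable ℝ V) (i j : Fin 3) (y : R3) :
    partialD V i j y = fderiv ℝ (fun y => V y j) y (EuclideanSpace.single i 1) := by
  have h : HasFDerivAt (fun y => V y j)
      ((EuclideanSpace.proj (𝕜 := ℝ) j : R3 →L[ℝ] ℝ).comp (fderiv ℝ V y)) y :=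
    (EuclideanSpace.proj (𝕜 := ℝ) j : R3 →L[ℝ] ℝ).hasFDerivAt.comp y (hd y).hasFDerivAt
  rw [h.fderiv]; rfl

/-- Write `H` for the kernel. Swapping indices turns `∂ᵢVⱼ Hₖₖ` into `∂ₖVⱼ Hᵢₖ`. The term `∂ⱼVₖ
Hᵢₖ`, summed over `k`, swaps into the divergence times `Hᵢⱼ` and integrates to zero, so it can be
subtracted to complete the curl. -/
lemma integral_strain_mul_trace (hd : Differentiable ℝ V)
    (hV : ∀ j, LinearGrowth fun y => V y j) (hdiv : ∀ y, divergence V y = 0) {a b : ℝ}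
    (ha : 0 < a) (hab : a ≤ b) (w : R3) :
    ∫ y, inner ℝ w (fderiv ℝ V y w) * ∑ k, gapHess a b k k y =
      ∫ y, stretchIntegrand a b V w y := by
  have hint (k j b' c : Fin 3) :
      Integrable fun y => partialD V k j y * gapHess a b b' c y := by
    simpa only [partialD_eq_fderiv_coord hd] using (hV j).integrable_fderiv_mul ha hab k b' c
  have hswap (k j b' c : Fin 3) : ∫ y, partialD V k j y * gapHess a b b' c y =
      ∫ y, partialD V b' j y * gapHess a b k c y := by
    simpa only [partialD_eq_fderiv_coord hd] using
      (hV j).integral_fderiv_mul_gapHess_swap ha hab k b' c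
  have hdiv0 (i j : Fin 3) : ∑ k, ∫ y, partialD V j k y * gapHess a b i k y = 0 := by
    simp_rw [gapHess_symm a b i, hswap j]
    rw [← integral_finsetSum _ fun k _ => hint _ _ _ _]
    simp_rw [← Finset.sum_mul]
    have h0 (y : R3) : ∑ k, partialD V k k y = 0 := hdiv y
    simp [h0]
  simp_rw [← sum_mul_partialD, stretchIntegrand]
  have e1 : ∀ y, (∑ i, ∑ j, w i * w j * partialD V i j y) * ∑ k, gapHess a b k k y =
      ∑ i, ∑ j, ∑ k, w i * w j * (partialD V i j y * gapHess a b k k y) := by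
    intro y
    simp only [Fin.sum_univ_three]; ring
  simp_rw [e1]
  have h3 {f : Fin 3 → Fin 3 → Fin 3 → R3 → ℝ} (hf : ∀ i j k, Integrable (f i j k)) :
      ∫ y, ∑ i, ∑ j, ∑ k, f i j k y = ∑ i, ∑ j, ∑ k, ∫ y, f i j k y := by
    rw [integral_finsetSum _ fun i _ => integrable_finsetSum _ fun j _ =>
      integrable_finsetSum _ fun k _ => hf i j k]
    refine Finset.sum_congr rfl fun i _ => ?_
    rw [integral_finsetSum _ fun j _ => integrable_finsetSum _ fun k _ => hf i j k]
    exact Finset.sum_congr rfl fun j _ => integral_finsetSum _ fun k _ => hf i j k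
  rw [h3 fun i j k => (hint _ _ _ _).const_mul _]
  simp only [sub_mul]
  rw [h3 (f := fun i j k y => w i * w j * (partialD V k j y * gapHess a b i k y -
    partialD V j k y * gapHess a b i k y))
    fun i j k => ((hint _ _ _ _).sub (hint _ _ _ _)).const_mul _]
  refine Finset.sum_congr rfl fun i _ => Finset.sum_congr rfl fun j _ => ?_
  simp only [integral_const_mul, ← Finset.mul_sum]
  simp_rw [integral_sub (hint _ _ _ _) (hint _ _ _ _)]
  rw [Finset.sum_sub_distrib, hdiv0, sub_zero]
  simp_rw [hswap i]

end VectorField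

/-! ### Removing the truncation. -/

lemma integral_mul_bump_rescale (f : R3 → ℝ) {ε : ℝ} (hε : 0 < ε) :
    ∫ y, f y * (3 * ε ^ 2 * (‖y‖ ^ 2 + ε ^ 2) ^ (-(5 / 2) : ℝ)) =
      ∫ y : R3, 3 * (f (ε • y) * (1 + ‖y‖ ^ 2) ^ (-(5 / 2) : ℝ)) := by
  have h := Measure.integral_comp_smul (volume : Measure R3)
    (fun y => f y * (3 * ε ^ 2 * (‖y‖ ^ 2 + ε ^ 2) ^ (-(5 / 2) : ℝ))) ε
  have e : ∀ y : R3, f (ε • y) * (3 * ε ^ 2 * (‖ε • y‖ ^ 2 + ε ^ 2) ^ (-(5 / 2) : ℝ)) =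
      (ε ^ 3)⁻¹ * (3 * (f (ε • y) * (1 + ‖y‖ ^ 2) ^ (-(5 / 2) : ℝ))) := by
    intro y
    have e1 : ‖ε • y‖ ^ 2 + ε ^ 2 = ε ^ 2 * (1 + ‖y‖ ^ 2) := by
      rw [norm_smul, Real.norm_of_nonneg hε.le]; ring
    have e2 : (ε ^ 2) ^ (-(5 / 2) : ℝ) = (ε ^ 5)⁻¹ := by
      rw [← Real.rpow_natCast, ← Real.rpow_mul hε.le, ← Real.rpow_natCast, ← Real.rpow_neg hε.le]
      norm_num
    rw [e1, Real.mul_rpow (by positivity) (by positivity), e2]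
    field_simp
  simp_rw [e] at h
  rw [integral_const_mul, finrank_euclideanSpace_fin, abs_of_pos (by positivity), smul_eq_mul] at h
  exact (mul_left_cancel₀ (by positivity) h).symm

/-- Dominated convergence, used both for concentration at the origin and for escape to infinity. The
point `y = 0` is excluded because dilations fix it, so the second limit fails there. -/
lemma tendsto_integral_bump_rescale {f : R3 → ℝ} (hf : Continuous f) {C : ℝ}
    (hC : ∀ y, |f y| ≤ C) {ι : Type*} {l : Filter ι} [l.IsCountablyGenerated] {e : ι → ℝ} {m : ℝ}
    (hlim : ∀ y : R3, y ≠ 0 → Filter.Tendsto (fun i => f (e i • y)) l (nhds m)) :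
    Filter.Tendsto (fun i => ∫ y : R3, 3 * (f (e i • y) * (1 + ‖y‖ ^ 2) ^ (-(5 / 2) : ℝ))) l
      (nhds (4 * Real.pi * m)) := by
  have hm : 4 * Real.pi * m = ∫ y : R3, 3 * (m * (1 + ‖y‖ ^ 2) ^ (-(5 / 2) : ℝ)) := by
    rw [integral_const_mul, integral_const_mul, integral_bump]; ring
  have hcb : Continuous fun y : R3 => (1 + ‖y‖ ^ 2) ^ (-(5 / 2) : ℝ) :=
    Continuous.rpow_const (by fun_prop) fun y => Or.inl (by positivity)
  rw [hm]
  refine tendsto_integral_filter_of_dominated_convergence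
    (fun y : R3 => 3 * (C * (1 + ‖y‖ ^ 2) ^ (-(5 / 2) : ℝ))) (.of_forall fun i => ?_)
    (.of_forall fun i => .of_forall fun y => ?_) ((integrable_bump.const_mul C).const_mul 3) ?_
  · exact (((hf.comp (continuous_const_smul (e i))).mul hcb).const_mul 3).aestronglyMeasurable
  · have hb : 0 ≤ (1 + ‖y‖ ^ 2) ^ (-(5 / 2) : ℝ) := by positivity
    rw [norm_mul, norm_mul, Real.norm_of_nonneg hb, Real.norm_of_nonneg (by norm_num : (0:ℝ) ≤ 3)]
    have := hC (e i • y)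
    simp only [Real.norm_eq_abs]
    gcongr
  · filter_upwards [compl_mem_ae_iff.2 (measure_singleton (0 : R3))] with y hy
    exact ((hlim y hy).mul_const _).const_mul 3

/-- The inner bump recovers the value at `0` and the outer one vanishes in the limit by decay. The
right-hand side is free of the truncation parameters and may be infinite, so `c` can be any
function. -/
theorem enorm_strain_le_lintegral {V : R3 → R3} (hV1 : ContDiff ℝ 1 V)
    (hV : ∀ j, LinearGrowth fun y => V y j) (hdiv : ∀ y, divergence V y = 0) (w : R3) {C : ℝ}
    (hC : ∀ y, |inner ℝ w (fderiv ℝ V y w)| ≤ C)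
    (h0 : Filter.Tendsto (fun y => inner ℝ w (fderiv ℝ V y w)) (Filter.cocompact R3) (nhds 0))
    (c : R3 → ℝ) :
    ENNReal.ofReal |4 * Real.pi * inner ℝ w (fderiv ℝ V 0 w)| ≤
      ∫⁻ y, ENNReal.ofReal (3 * ‖w‖ ^ 2 * (‖y‖ ^ 3)⁻¹ * ‖curl V y - c y • w‖) := by
  set f : R3 → ℝ := fun y => inner ℝ w (fderiv ℝ V y w) with hf
  have hfc : Continuous f :=
    continuous_const.inner ((hV1.continuous_fderiv one_ne_zero).clm_apply continuous_const)
  -- The truncation uses `a = (n+1)⁻²` and `b = (n+1)²`, that is, bumps at scales `1/(n+1)` and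
  -- `n+1`.
  have hsm := tendsto_integral_bump_rescale hfc hC (l := Filter.atTop)
    (e := fun n : ℕ => ((n : ℝ) + 1)⁻¹) (m := f 0) fun y _ => by
      have : Filter.Tendsto (fun n : ℕ => ((n : ℝ) + 1)⁻¹ • y) Filter.atTop (nhds 0) := by
        simpa [one_div] using (tendsto_one_div_add_atTop_nhds_zero_nat (𝕜 := ℝ)).smul_const y
      exact (hfc.tendsto 0).comp this
  have hlg := tendsto_integral_bump_rescale hfc hC (l := Filter.atTop)
    (e := fun n : ℕ => (n : ℝ) + 1) (m := 0) fun y hy => by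
      refine h0.comp ?_
      rw [← Metric.cobounded_eq_cocompact, ← comap_norm_atTop, Filter.tendsto_comap_iff]
      simp only [Function.comp_def, norm_smul]
      refine Filter.Tendsto.atTop_mul_const (norm_pos_iff.2 hy) ?_
      refine Filter.tendsto_atTop_mono (fun n : ℕ => ?_) tendsto_natCast_atTop_atTop
      exact (le_abs_self ((n : ℝ) + 1)).trans' (by linarith)
  have hlim := (ENNReal.continuous_ofReal.tendsto _).comp ((hsm.sub hlg).abs)
  rw [mul_zero, sub_zero] at hlim
  refine le_of_tendsto hlim (.of_forall fun n => ?_)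
  have hn : (0 : ℝ) < (n : ℝ) + 1 := by positivity
  have ha : 0 < (((n : ℝ) + 1)⁻¹) ^ 2 := by positivity
  have hb : 0 < ((n : ℝ) + 1) ^ 2 := by positivity
  have hab : (((n : ℝ) + 1)⁻¹) ^ 2 ≤ ((n : ℝ) + 1) ^ 2 := by
    have h1 : (1 : ℝ) ≤ (n : ℝ) + 1 := by linarith [n.cast_nonneg (α := ℝ)]
    have := inv_le_one_of_one_le₀ h1
    gcongr; exact this.trans h1
  have hid := integral_strain_mul_trace (hV1.differentiable one_ne_zero) hV hdiv ha hab w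
  have hbi (ε : ℝ) (hε : 0 < ε) : Integrable fun y : R3 =>
      f y * (3 * ε ^ 2 * (‖y‖ ^ 2 + ε ^ 2) ^ (-(5 / 2) : ℝ)) := by
    have hbump : Integrable fun y : R3 =>
        3 * ε ^ 2 * (‖y‖ ^ 2 + ε ^ 2) ^ (-(5 / 2) : ℝ) := by
      have := (integrable_bump.const_mul (ε ^ 2)).comp_smul (inv_ne_zero hε.ne')
      refine ((this.const_mul ((ε ^ 2) ^ (-(5 / 2) : ℝ))).const_mul 3).congr (.of_forall fun y => ?_)
      have e1 : ‖y‖ ^ 2 + ε ^ 2 = ε ^ 2 * (1 + ‖ε⁻¹ • y‖ ^ 2) := by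
        rw [norm_smul, Real.norm_of_nonneg (by positivity)]; field_simp; ring
      simp only
      rw [e1, Real.mul_rpow (by positivity) (by positivity)]; ring
    exact hbump.bdd_mul hfc.aestronglyMeasurable (.of_forall hC)
  simp only [sum_gapHess_diag ha hb, mul_sub] at hid
  rw [integral_sub (hbi _ (by positivity)) (hbi _ hn), integral_mul_bump_rescale _ (by positivity),
    integral_mul_bump_rescale _ hn] at hid
  simp only [Function.comp_apply]
  rw [hid, ← Real.norm_eq_abs, ofReal_norm]
  refine (enorm_integral_le_lintegral_enorm _).trans (lintegral_mono fun y => ?_)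
  rw [← ofReal_norm]
  exact ENNReal.ofReal_le_ofReal (abs_stretchIntegrand_le ha hab V w y (c y))

/-! ### Far-field estimate and choice of radius. -/

/-- Hölder's inequality, with the dual norm of `|y|⁻³` outside the ball computed exactly. At `p = 1`
the conjugate exponent is infinite and the supremum `R⁻³` replaces it; the constant agrees because
`0 ^ 0 = 1`. -/
lemma lintegral_far_field_le {F : R3 → R3} (hF : Continuous F) {p R : ℝ} (hp : 1 ≤ p)
    (hR : 0 < R) :
    ∫⁻ y in (Metric.ball (0 : R3) R)ᶜ, ENNReal.ofReal ((‖y‖ ^ 3)⁻¹) * ‖F y‖ₑ ≤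
      ENNReal.ofReal ((4 * Real.pi / 3 * (p - 1)) ^ ((p - 1) / p) * R ^ (-(3 / p))) *
        eLpNorm F (ENNReal.ofReal p) volume := by
  have hmeas : MeasurableSet (Metric.ball (0 : R3) R)ᶜ := Metric.isOpen_ball.measurableSet.compl
  rcases hp.eq_or_lt with rfl | hp1
  · simp only [sub_self, mul_zero, Real.rpow_zero, one_mul, ENNReal.ofReal_one,
      div_one, eLpNorm_one_eq_lintegral_enorm]
    calc _ ≤ ∫⁻ y in (Metric.ball (0 : R3) R)ᶜ, ENNReal.ofReal (R ^ (-3 : ℝ)) * ‖F y‖ₑ := by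
          refine setLIntegral_mono' hmeas fun y hy => ?_
          have hy' : R ≤ ‖y‖ := by simpa using hy
          have e : R ^ (-3 : ℝ) = (R ^ 3)⁻¹ := by
            rw [Real.rpow_neg hR.le, ← Real.rpow_natCast]; norm_num
          rw [e]
          gcongr
      _ ≤ ∫⁻ y, ENNReal.ofReal (R ^ (-3 : ℝ)) * ‖F y‖ₑ := setLIntegral_le_lintegral _ _
      _ = _ := lintegral_const_mul' _ _ ENNReal.ofReal_ne_top
  · have hq : p.HolderConjugate (p / (p - 1)) := Real.HolderConjugate.conjExponent hp1
    have hp0 : 0 < p := by linarith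
    have hp2 : 0 < p - 1 := by linarith
    have h := ENNReal.lintegral_mul_le_Lp_mul_Lq
      (volume.restrict (Metric.ball (0 : R3) R)ᶜ) hq.symm
      (f := fun y => ENNReal.ofReal ((‖y‖ ^ 3)⁻¹)) (g := fun y => ‖F y‖ₑ)
      (by fun_prop) (by fun_prop)
    refine h.trans ?_
    have e1 (y : R3) : ENNReal.ofReal ((‖y‖ ^ 3)⁻¹) ^ (p / (p - 1)) =
        ENNReal.ofReal (‖y‖ ^ (-(3 * (p / (p - 1))))) := by
      rw [ENNReal.ofReal_rpow_of_nonneg (by positivity) (by positivity),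
        Real.inv_rpow (by positivity), Real.rpow_neg (by positivity), Real.rpow_mul (by positivity)]
      norm_cast
    have hs : 3 < 3 * (p / (p - 1)) := by
      have : 1 < p / (p - 1) := by rw [one_lt_div hp2]; linarith
      linarith
    have e2 : 4 * Real.pi * (R ^ (3 - 3 * (p / (p - 1))) / (3 * (p / (p - 1)) - 3)) =
        (4 * Real.pi / 3 * (p - 1)) * R ^ (-(3 / (p - 1))) := by
      rw [show 3 - 3 * (p / (p - 1)) = -(3 / (p - 1)) by field_simp; ring,
        show 3 * (p / (p - 1)) - 3 = 3 / (p - 1) by field_simp; ring]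
      field_simp
    simp_rw [e1]
    rw [setLIntegral_compl_ball_rpow hR hs, e2, ENNReal.ofReal_rpow_of_nonneg (by positivity)
      (by positivity), Real.mul_rpow (by positivity) (by positivity), ← Real.rpow_mul hR.le,
      one_div_div, show -(3 / (p - 1)) * ((p - 1) / p) = -(3 / p) by field_simp,
      eLpNorm_eq_lintegral_rpow_enorm_toReal (by simpa using hp0) ENNReal.ofReal_ne_top,
      ENNReal.toReal_ofReal hp0.le]
    gcongr
    exact Measure.restrict_le_self

/-- The radius `(K / G) ^ (p / (p + 3))` makes the two terms equal, whence the factor `2`. If `G` or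
`K` vanishes, a suitable `R` pushes the right-hand side below one. -/
lemma one_le_of_forall_radius {p G K : ℝ} (hp : 1 ≤ p) (hG : 0 ≤ G) (hK : 0 ≤ K)
    (h : ∀ R, 0 < R → 1 ≤ R * G + K * R ^ (-(3 / p))) :
    1 ≤ 2 * (G ^ (3 / (p + 3)) * K ^ (p / (p + 3))) := by
  have hp0 : 0 < p := by linarith
  rcases hK.eq_or_lt with rfl | hK
  · exfalso
    have h1 := h (1 / (2 * (G + 1))) (by positivity)
    have h2 : 1 / (2 * (G + 1)) * G ≤ 1 / 2 := by
      rw [div_mul_eq_mul_div, div_le_div_iff₀ (by positivity) (by positivity)]; linarith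
    linarith
  rcases hG.eq_or_lt with rfl | hG
  · exfalso
    -- This radius makes the remaining term exactly `1/2`.
    have h1 := h ((2 * K) ^ (p / 3)) (by positivity)
    rw [← Real.rpow_mul (by positivity), show p / 3 * -(3 / p) = -1 by field_simp,
      Real.rpow_neg_one] at h1
    have : K * (2 * K)⁻¹ = 1 / 2 := by field_simp
    linarith
  · have h1 := h ((K / G) ^ (p / (p + 3))) (by positivity)
    have e1 : (K / G) ^ (p / (p + 3)) * G = G ^ (3 / (p + 3)) * K ^ (p / (p + 3)) := by
      have : G ^ (3 / (p + 3)) * G ^ (p / (p + 3)) = G := by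
        rw [← Real.rpow_add hG, show 3 / (p + 3) + p / (p + 3) = 1 by field_simp; ring,
          Real.rpow_one]
      rw [Real.div_rpow hK.le hG.le, div_mul_eq_mul_div, div_eq_iff (by positivity)]
      linear_combination (-K ^ (p / (p + 3))) * this
    have e2 : K * ((K / G) ^ (p / (p + 3))) ^ (-(3 / p)) =
        G ^ (3 / (p + 3)) * K ^ (p / (p + 3)) := by
      have : K ^ (3 / (p + 3)) * K ^ (p / (p + 3)) = K := by
        rw [← Real.rpow_add hK, show 3 / (p + 3) + p / (p + 3) = 1 by field_simp; ring,
          Real.rpow_one]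
      rw [← Real.rpow_mul (by positivity),
        show p / (p + 3) * -(3 / p) = -(3 / (p + 3)) by field_simp,
        Real.rpow_neg (by positivity), Real.div_rpow hK.le hG.le, inv_div, ← mul_div_assoc,
        div_eq_iff (by positivity)]
      linear_combination (-G ^ (3 / (p + 3))) * this
    rw [e1, e2] at h1
    linarith

/-! ### Consequences of the decay bounds and the maximum point. -/

lemma one_le_bracket (y : R3) : 1 ≤ bracket y :=
  Real.one_le_sqrt.2 (by linarith [sq_nonneg ‖y‖])

lemma bracket_rpow_le_one {γ : ℝ} (hγ : 0 < γ) (y : R3) : bracket y ^ (-(1 / γ)) ≤ 1 :=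
  Real.rpow_le_one_of_one_le_of_nonpos (one_le_bracket y) (by
    have : 0 < 1 / γ := by positivity
    linarith)

lemma tendsto_bracket_rpow {γ : ℝ} (hγ : 0 < γ) :
    Filter.Tendsto (fun y => bracket y ^ (-(1 / γ))) (Filter.cocompact R3) (nhds 0) := by
  refine (tendsto_rpow_neg_atTop (by positivity : 0 < 1 / γ)).comp ?_
  refine Filter.tendsto_atTop_mono (fun y => ?_) (tendsto_norm_cocompact_atTop (E := R3))
  exact Real.le_sqrt_of_sq_le (by linarith)

lemma HasProfileDecay.memLp_vorticity {γ : ℝ} (hγ : 0 < γ) {U Ω : R3 → R3}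
    (hdecay : HasProfileDecay γ U Ω) (hΩ : Continuous Ω) {p : ℝ} (hp : 3 * γ < p) :
    MemLp Ω (ENNReal.ofReal p) volume := by
  obtain ⟨C, hC, hb⟩ := hdecay
  have hp0 : 0 < p := by nlinarith
  rw [← integrable_norm_rpow_iff hΩ.aestronglyMeasurable (by simpa using hp0)
    ENNReal.ofReal_ne_top, ENNReal.toReal_ofReal hp0.le]
  refine integrable_of_abs_le_rpow (r := p / γ) (K := C ^ p) (by rwa [lt_div_iff₀ hγ])
    (hΩ.norm.rpow_const fun _ => Or.inr hp0.le) fun y => ?_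
  have hbr : 0 ≤ bracket y := zero_le_one.trans (one_le_bracket y)
  have e : (bracket y ^ (-(1 / γ))) ^ p = (1 + ‖y‖ ^ 2) ^ (-(p / γ) / 2) := by
    rw [← Real.rpow_mul hbr, bracket, Real.sqrt_eq_rpow, ← Real.rpow_mul (by positivity)]
    congr 1; field_simp
  rw [abs_of_nonneg (by positivity), ← e, ← Real.mul_rpow hC.le (by positivity)]
  refine Real.rpow_le_rpow (norm_nonneg _) ?_ hp0.le
  linarith [(hb y).2, norm_nonneg (fderiv ℝ U y)]

/-- At a maximum point of `|Ω|` the stretching rate equals one. -/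
lemma IsSelfSimilarEuler.inner_strain_eq_of_max {γ : ℝ} {U Ω : R3 → R3}
    (hsol : IsSelfSimilarEuler γ U Ω) {x : R3} (hx : ∀ y, ‖Ω y‖ ≤ ‖Ω x‖) :
    inner ℝ (Ω x) (fderiv ℝ U x (Ω x)) = ‖Ω x‖ ^ 2 := by
  have hd := (hsol.contDiff_vorticity.differentiable one_ne_zero x).hasFDerivAt
  have hmax : IsLocalMax (fun y => ‖Ω y‖ ^ 2) x :=
    .of_forall fun y => pow_le_pow_left₀ (norm_nonneg _) (hx y) 2
  have h0 (v : R3) : inner ℝ (Ω x) (fderiv ℝ Ω x v) = 0 := by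
    have := hmax.hasFDerivAt_eq_zero hd.norm_sq
    have := congrArg (fun L : R3 →L[ℝ] ℝ => L v) this
    simpa using this
  have h := congrArg (fun v => inner ℝ (Ω x) v) (hsol.equation x)
  simp only [advect, inner_add_right, inner_smul_right, h0, mul_zero, add_zero,
    real_inner_self_eq_norm_sq] at h
  exact h.symm

lemma HasProfileDecay.exists_max {γ : ℝ} (hγ : 0 < γ) {U Ω : R3 → R3}
    (hdecay : HasProfileDecay γ U Ω) (hΩ : Continuous Ω) : ∃ x, ∀ y, ‖Ω y‖ ≤ ‖Ω x‖ := by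
  obtain ⟨C, hC, hb⟩ := hdecay
  by_cases hne : ∃ y, Ω y ≠ 0
  · obtain ⟨y0, hy0⟩ := hne
    have hlim : Filter.Tendsto (fun y => ‖Ω y‖) (Filter.cocompact R3) (nhds 0) := by
      refine squeeze_zero (fun _ => norm_nonneg _) (fun y => ?_)
        (((tendsto_bracket_rpow hγ).const_mul C).trans (by rw [mul_zero]))
      linarith only [(hb y).2, norm_nonneg (fderiv ℝ U y)]
    exact hΩ.norm.exists_forall_ge' y0
      ((hlim.eventually_lt_const (norm_pos_iff.2 hy0)).mono fun _ h => h.le)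
  · push Not at hne
    exact ⟨0, fun y => by simp [hne]⟩

/-- The essential bound holds on a closed set of full measure, which is dense and hence everything.
-/
lemma norm_fderiv_le_eLpNorm_top {Ω : R3 → R3} (hΩ : ContDiff ℝ 1 Ω)
    (hG : eLpNorm (fderiv ℝ Ω) ∞ volume ≠ ∞) (y : R3) :
    ‖fderiv ℝ Ω y‖ ≤ (eLpNorm (fderiv ℝ Ω) ∞ volume).toReal := by
  have hc : Continuous (fderiv ℝ Ω) := hΩ.continuous_fderiv one_ne_zero
  have hcl : IsClosed {y | ‖fderiv ℝ Ω y‖ ≤ (eLpNorm (fderiv ℝ Ω) ∞ volume).toReal} :=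
    isClosed_le hc.norm continuous_const
  have hae : ∀ᵐ y, ‖fderiv ℝ Ω y‖ ≤ (eLpNorm (fderiv ℝ Ω) ∞ volume).toReal := by
    filter_upwards [ae_le_eLpNormEssSup (f := fderiv ℝ Ω) (μ := volume)] with y hy
    rw [← eLpNorm_exponent_top] at hy
    simpa using ENNReal.toReal_mono hG hy
  have := (Measure.dense_of_ae hae).closure_eq
  rw [hcl.closure_eq] at this
  exact Set.eq_univ_iff_forall.1 this y

lemma linearGrowth_translate {γ : ℝ} (hγ : 0 < γ) {U Ω : R3 → R3}
    (hU : ContDiff ℝ 1 U) (hdecay : HasProfileDecay γ U Ω) (x : R3) (j : Fin 3) :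
    LinearGrowth fun y => U (x + y) j := by
  obtain ⟨C, hC, hb⟩ := hdecay
  have hV : ContDiff ℝ 1 fun y => U (x + y) := hU.comp (contDiff_const.add contDiff_id)
  refine ⟨(EuclideanSpace.proj (𝕜 := ℝ) j : R3 →L[ℝ] ℝ).contDiff.comp hV,
    C * (‖x‖ + 1), by positivity, fun y => ⟨?_, ?_⟩⟩
  · have h1 : 1 ≤ (1 + ‖y‖ ^ 2) ^ (1 / 2 : ℝ) := by
      rw [← Real.sqrt_eq_rpow]; exact one_le_bracket y
    have h2 : ‖y‖ ≤ (1 + ‖y‖ ^ 2) ^ (1 / 2 : ℝ) := by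
      rw [← Real.sqrt_eq_rpow]; exact Real.le_sqrt_of_sq_le (by linarith)
    calc |U (x + y) j| ≤ ‖U (x + y)‖ := by
          rw [← Real.norm_eq_abs]; exact PiLp.norm_apply_le _ j
      _ ≤ C * ‖x + y‖ * bracket (x + y) ^ (-(1 / γ)) := (hb _).1
      _ ≤ C * ‖x + y‖ * 1 := by gcongr; exact bracket_rpow_le_one hγ _
      _ ≤ C * (‖x‖ + ‖y‖) := by rw [mul_one]; gcongr; exact norm_add_le _ _
      _ ≤ C * ((‖x‖ + 1) * (1 + ‖y‖ ^ 2) ^ (1 / 2 : ℝ)) := by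
          gcongr; nlinarith [norm_nonneg x]
      _ = _ := by ring
  · have h : HasFDerivAt (fun y => U (x + y) j)
        ((EuclideanSpace.proj (𝕜 := ℝ) j : R3 →L[ℝ] ℝ).comp (fderiv ℝ (fun y => U (x + y)) y)) y :=
      (EuclideanSpace.proj (𝕜 := ℝ) j : R3 →L[ℝ] ℝ).hasFDerivAt.comp y
        (hV.differentiable one_ne_zero y).hasFDerivAt
    rw [h.fderiv, fderiv_comp_add_left]
    have h3 : ‖fderiv ℝ U (x + y)‖ ≤ C := by
      have := mul_le_mul_of_nonneg_left (bracket_rpow_le_one hγ (x + y)) hC.le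
      linarith [(hb (x + y)).2, norm_nonneg (Ω (x + y))]
    refine ContinuousLinearMap.opNorm_le_bound _ (by positivity) fun v => ?_
    calc _ ≤ ‖fderiv ℝ U (x + y) v‖ := PiLp.norm_apply_le _ j
      _ ≤ C * ‖v‖ := (ContinuousLinearMap.le_opNorm _ _).trans (by gcongr)
      _ ≤ C * (‖x‖ + 1) * ‖v‖ := by
        gcongr; nlinarith [norm_nonneg x]

/-! ### The inequality at a fixed radius, and the conclusion. -/

lemma IsSelfSimilarEuler.radius_bound {γ : ℝ} (hγ : 0 < γ) {U Ω : R3 → R3}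
    (hsol : IsSelfSimilarEuler γ U Ω) (hdecay : HasProfileDecay γ U Ω)
    (hne : ∃ y, Ω y ≠ 0) {p G R : ℝ} (hp : 1 ≤ p) (hG : ∀ y, ‖fderiv ℝ Ω y‖ ≤ G) (hR : 0 < R) :
    ENNReal.ofReal (4 * Real.pi / 3) ≤ ENNReal.ofReal (4 * Real.pi * R * G) +
      ENNReal.ofReal ((4 * Real.pi / 3 * (p - 1)) ^ ((p - 1) / p) * R ^ (-(3 / p))) *
        eLpNorm Ω (ENNReal.ofReal p) volume := by
  have hΩc := hsol.contDiff_vorticity.continuous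
  have hU := hsol.contDiff_velocity
  obtain ⟨x, hx⟩ := hdecay.exists_max hγ hΩc
  have hx0 : 0 < ‖Ω x‖ := hne.elim fun y hy => (norm_pos_iff.2 hy).trans_le (hx y)
  have hG0 : 0 ≤ G := (norm_nonneg _).trans (hG 0)
  set w := Ω x with hw
  set V : R3 → R3 := fun y => U (x + y) with hVdef
  have hfd (y : R3) : fderiv ℝ V y = fderiv ℝ U (x + y) := fderiv_comp_add_left _
  have hV1 : ContDiff ℝ 1 V := hU.comp (contDiff_const.add contDiff_id)
  have hcurl (y : R3) : curl V y = Ω (x + y) := by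
    rw [hsol.vorticity_eq]; simp only [curl, partialD, hfd]
  have hdiv (y : R3) : divergence V y = 0 := by
    rw [← hsol.div_free (x + y)]; simp only [divergence, partialD, hfd]
  obtain ⟨C, hC, hb⟩ := id hdecay
  have hin (y : R3) : |inner ℝ w (fderiv ℝ V y w)| ≤
      ‖w‖ ^ 2 * (C * bracket (x + y) ^ (-(1 / γ))) := by
    rw [hfd]
    calc _ ≤ ‖w‖ * ‖fderiv ℝ U (x + y) w‖ := abs_real_inner_le_norm _ _
      _ ≤ ‖w‖ * (C * bracket (x + y) ^ (-(1 / γ)) * ‖w‖) := by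
        gcongr
        refine ContinuousLinearMap.le_of_opNorm_le _ ?_ _
        linarith [(hb (x + y)).2, norm_nonneg (Ω (x + y))]
      _ = _ := by ring
  have hin1 (y : R3) : |inner ℝ w (fderiv ℝ V y w)| ≤ ‖w‖ ^ 2 * (C * 1) :=
    (hin y).trans (by gcongr; exact bracket_rpow_le_one hγ _)
  have hlim : Filter.Tendsto (fun y => inner ℝ w (fderiv ℝ V y w)) (Filter.cocompact R3)
      (nhds 0) := by
    refine squeeze_zero_norm hin ?_
    have := (tendsto_bracket_rpow hγ).comp
      (Homeomorph.addLeft x).isClosedEmbedding.tendsto_cocompact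
    simpa using (this.const_mul C).const_mul (‖w‖ ^ 2)
  classical
  -- The origin is moved to the maximum point, and `w` is subtracted only inside the ball: the
  -- difference is small there, while outside it `w` would not be integrable against `|y|⁻³`.
  have key := enorm_strain_le_lintegral hV1
    (linearGrowth_translate hγ hU hdecay x) hdiv w hin1 hlim
    (fun y => if y ∈ Metric.ball (0 : R3) R then 1 else 0)
  have hstr : inner ℝ w (fderiv ℝ V 0 w) = ‖w‖ ^ 2 := by
    rw [hfd, add_zero]; exact hsol.inner_strain_eq_of_max hx
  rw [hstr, abs_of_nonneg (by positivity)] at key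
  have hbm : MeasurableSet (Metric.ball (0 : R3) R) := Metric.isOpen_ball.measurableSet
  rw [← lintegral_add_compl _ hbm] at key
  have hnear : ∫⁻ y in Metric.ball (0 : R3) R, ENNReal.ofReal (3 * ‖w‖ ^ 2 * (‖y‖ ^ 3)⁻¹ *
      ‖curl V y - (if y ∈ Metric.ball (0 : R3) R then (1 : ℝ) else 0) • w‖) ≤
      ENNReal.ofReal (3 * ‖w‖ ^ 2) * ENNReal.ofReal (4 * Real.pi * R * G) := by
    calc _ ≤ ∫⁻ y in Metric.ball (0 : R3) R,
          ENNReal.ofReal (3 * ‖w‖ ^ 2 * G) * ENNReal.ofReal ((‖y‖ ^ 2)⁻¹) := by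
          refine setLIntegral_mono' hbm fun y hy => ?_
          rw [← ENNReal.ofReal_mul (by positivity)]
          refine ENNReal.ofReal_le_ofReal ?_
          rw [if_pos hy, one_smul, hcurl]
          have hmv : ‖Ω (x + y) - w‖ ≤ G * ‖y‖ := by
            have := convex_univ.norm_image_sub_le_of_norm_fderiv_le (𝕜 := ℝ) (f := Ω)
              (fun z _ => hsol.contDiff_vorticity.differentiable one_ne_zero z)
              (fun z _ => hG z) (Set.mem_univ x) (Set.mem_univ (x + y))
            simpa using this
          calc _ ≤ 3 * ‖w‖ ^ 2 * (‖y‖ ^ 3)⁻¹ * (G * ‖y‖) := by gcongr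
            _ = 3 * ‖w‖ ^ 2 * G * (‖y‖ ^ 2)⁻¹ := by
              rcases eq_or_ne y 0 with rfl | hy0
              · simp
              · have := norm_ne_zero_iff.2 hy0
                field_simp
      _ = _ := by
          rw [lintegral_const_mul' _ _ ENNReal.ofReal_ne_top, setLIntegral_ball_inv_sq hR,
            ← ENNReal.ofReal_mul (by positivity), ← ENNReal.ofReal_mul (by positivity)]
          congr 1; ring
  have hfar : ∫⁻ y in (Metric.ball (0 : R3) R)ᶜ, ENNReal.ofReal (3 * ‖w‖ ^ 2 * (‖y‖ ^ 3)⁻¹ *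
      ‖curl V y - (if y ∈ Metric.ball (0 : R3) R then (1 : ℝ) else 0) • w‖) ≤
      ENNReal.ofReal (3 * ‖w‖ ^ 2) *
      (ENNReal.ofReal ((4 * Real.pi / 3 * (p - 1)) ^ ((p - 1) / p) * R ^ (-(3 / p))) *
        eLpNorm Ω (ENNReal.ofReal p) volume) := by
    have ht : eLpNorm (fun y => Ω (x + y)) (ENNReal.ofReal p) volume =
        eLpNorm Ω (ENNReal.ofReal p) volume :=
      eLpNorm_comp_measurePreserving hΩc.aestronglyMeasurable
        (measurePreserving_add_left volume x)
    rw [← ht]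
    calc _ = ∫⁻ y in (Metric.ball (0 : R3) R)ᶜ, ENNReal.ofReal (3 * ‖w‖ ^ 2) *
          (ENNReal.ofReal ((‖y‖ ^ 3)⁻¹) * ‖Ω (x + y)‖ₑ) := by
          refine setLIntegral_congr_fun hbm.compl fun y hy => ?_
          rw [if_neg hy, zero_smul, sub_zero, hcurl, ENNReal.ofReal_mul (by positivity),
            ENNReal.ofReal_mul (by positivity), ofReal_norm, mul_assoc]
      _ ≤ _ := by
          rw [lintegral_const_mul' _ _ ENNReal.ofReal_ne_top]
          gcongr
          exact lintegral_far_field_le (hΩc.comp (continuous_const.add continuous_id)) hp hR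
  have h := key.trans (add_le_add hnear hfar)
  rw [← mul_add, show 4 * Real.pi * ‖w‖ ^ 2 = 3 * ‖w‖ ^ 2 * (4 * Real.pi / 3) by ring,
    ENNReal.ofReal_mul (by positivity)] at h
  -- Both sides carry the factor `3|w|²`, which is positive because `Ω` is not identically zero.
  exact (ENNReal.mul_le_mul_iff_right (by simpa using hx0) ENNReal.ofReal_ne_top).1 h

lemma stretchConst_pos {p : ℝ} (hp : 1 ≤ p) : 0 < stretchConst p := by
  have h : 0 < (p - 1) ^ ((p - 1) / (p + 3)) := by
    rcases hp.eq_or_lt with rfl | hp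
    · simp
    · exact Real.rpow_pos_of_pos (by linarith) _
  unfold stretchConst
  positivity

/-- Powers of `k = 3/(4π)` combine as `1 - (p-1)/p = 1/p`, and the outer exponent `p/(p+3)` turns
this into `1/(p+3)`. -/
lemma stretchConst_mul_eq {p G A : ℝ} (hp : 1 ≤ p) (hG : 0 ≤ G) (hA : 0 ≤ A) :
    2 * ((6 * G) ^ (3 / (p + 3)) * (3 / (4 * Real.pi) *
      ((4 * Real.pi / 3 * (p - 1)) ^ ((p - 1) / p) * A)) ^ (p / (p + 3))) =
      stretchConst p * (G ^ (3 / (p + 3)) * A ^ (p / (p + 3))) := by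
  have hp0 : 0 < p := by linarith
  have hp1 : 0 ≤ p - 1 := by linarith
  set k := 3 / (4 * Real.pi) with hk
  have hk0 : 0 < k := by positivity
  have e0 : 4 * Real.pi / 3 = k⁻¹ := by rw [hk, inv_div]
  have e1 : k * ((k⁻¹ * (p - 1)) ^ ((p - 1) / p) * A) =
      k ^ (1 / p) * ((p - 1) ^ ((p - 1) / p) * A) := by
    rw [Real.mul_rpow (by positivity) hp1, Real.inv_rpow hk0.le, ← Real.rpow_neg hk0.le,
      ← mul_assoc, ← mul_assoc, ← Real.rpow_one_add' hk0.le (by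
        rw [show 1 + -((p - 1) / p) = 1 / p by field_simp; ring]; positivity),
      show 1 + -((p - 1) / p) = 1 / p by field_simp; ring, mul_assoc]
  rw [e0, e1, Real.mul_rpow (by positivity) (by positivity),
    Real.mul_rpow (x := k ^ (1 / p)) (by positivity) (by positivity),
    Real.mul_rpow (y := A) (by positivity) hA, ← Real.rpow_mul hk0.le, ← Real.rpow_mul hp1,
    show 1 / p * (p / (p + 3)) = 1 / (p + 3) by field_simp,
    show (p - 1) / p * (p / (p + 3)) = (p - 1) / (p + 3) by field_simp]
  simp only [stretchConst, ← hk]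
  ring

theorem mainTheorem3 (γ : ℝ) (hγ : 0 < γ) (U Ω : R3 → R3)
    (hsol : IsSelfSimilarEuler γ U Ω) (hdecay : HasProfileDecay γ U Ω)
    (hne : ∃ y, Ω y ≠ 0) (p : ℝ) (hp1 : 1 ≤ p) (hp : 3 * γ < p) :
    ENNReal.ofReal ((stretchConst p)⁻¹) ≤
      eLpNorm (fderiv ℝ Ω) ∞ volume ^ (3 / (p + 3)) *
        eLpNorm Ω (ENNReal.ofReal p) volume ^ (p / (p + 3)) := by
  have hp0 : 0 < p := by linarith
  have h3 : 0 < 3 / (p + 3) := by positivity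
  have hp3 : 0 < p / (p + 3) := by positivity
  have hΩ := hsol.contDiff_vorticity
  have hA0 : eLpNorm Ω (ENNReal.ofReal p) volume ≠ 0 := by
    rw [Ne, eLpNorm_eq_zero_iff hΩ.continuous.aestronglyMeasurable (by simpa using hp0),
      hΩ.continuous.ae_eq_iff_eq volume continuous_zero]
    exact fun h => hne.elim fun y hy => hy (congrFun h y)
  rcases eq_or_ne (eLpNorm (fderiv ℝ Ω) ∞ volume) ∞ with hG | hG
  · rw [hG, ENNReal.top_rpow_of_pos h3, ENNReal.top_mul]
    · exact le_top
    · rw [Ne, ENNReal.rpow_eq_zero_iff_of_pos hp3]; exact hA0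
  have hG1 := norm_fderiv_le_eLpNorm_top hΩ hG
  rw [← ENNReal.ofReal_toReal hG]
  set G := (eLpNorm (fderiv ℝ Ω) ∞ volume).toReal
  have hG0 : 0 ≤ G := ENNReal.toReal_nonneg
  have hrad (R : ℝ) (hR : 0 < R) := hsol.radius_bound hγ hdecay hne hp1 hG1 hR
  have hA : eLpNorm Ω (ENNReal.ofReal p) volume ≠ ∞ :=
    (hdecay.memLp_vorticity hγ hΩ.continuous hp).eLpNorm_ne_top
  rw [← ENNReal.ofReal_toReal hA] at hrad ⊢
  set A := (eLpNorm Ω (ENNReal.ofReal p) volume).toReal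
  have hA0 : 0 ≤ A := ENNReal.toReal_nonneg
  rw [ENNReal.ofReal_rpow_of_nonneg hG0 h3.le, ENNReal.ofReal_rpow_of_nonneg hA0 hp3.le,
    ← ENNReal.ofReal_mul (by positivity)]
  refine ENNReal.ofReal_le_ofReal ?_
  have hc : 0 ≤ p - 1 := by linarith
  -- Normalising `radius_bound` gives `3 * G`; it is relaxed to `6 * G` to match the `6` in
  -- `stretchConst`.
  have h := one_le_of_forall_radius (p := p) (G := 6 * G) (K := 3 / (4 * Real.pi) *
      ((4 * Real.pi / 3 * (p - 1)) ^ ((p - 1) / p) * A)) hp1 (by positivity) (by positivity)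
    fun R hR => by
      have h := hrad R hR
      rw [← ENNReal.ofReal_mul (by positivity), ← ENNReal.ofReal_add (by positivity)
        (by positivity), ENNReal.ofReal_le_ofReal_iff (by positivity)] at h
      have hpi := Real.pi_pos
      have h' := mul_le_mul_of_nonneg_left h (by positivity : 0 ≤ 3 / (4 * Real.pi))
      have e1 : 3 / (4 * Real.pi) * (4 * Real.pi / 3) = 1 := by field_simp
      have e2 : 3 / (4 * Real.pi) * (4 * Real.pi * R * G) = 3 * (R * G) := by field_simp
      rw [mul_add, e1, e2] at h'
      have : 0 ≤ R * G := by positivity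
      linarith
  rw [stretchConst_mul_eq hp1 hG0 hA0] at h
  exact (inv_le_iff_one_le_mul₀' (stretchConst_pos hp1)).2 h
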